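/- All Hilbert spaces are finite-dimensional, a state is a positive semidefinite operator of trace one, and logarithms are to base 2. Write $S(\rho)=-\operatorname{tr}\rho\log\rho$ for the von Neumann entropy and $S(\rho|\sigma)=\operatorname{tr}\rho\log\rho-\operatorname{tr}\rho\log\sigma$ for the relative entropy (equal to $+\infty$ if the support of $\rho$ is not contained in that of $\sigma$). A state on $\mathcal H_A\otimes\mathcal H_B$ is separable if it is a convex combination of product states $\alpha\otimes\beta$. The relative entropy of entanglement of a state $\rho$ on $\mathcal H_A\otimes\mathcal H_B$ is $$E_r(\rho)=\inf\{S(\rho|\sigma):\sigma \text{ a separable state on } \mathcal H_A\otimes\mathcal H_B\}.$$ A CLOCC (closed local operations and classical communication) operation is any map obtained by composing finitely many operations of the following kinds: (i) local unitary transformations $\rho\mapsto(U_A\otimes U_B)\,\rho\,(U_A\otimes U_B)^\dagger$; (ii) sending a subsystem through a completely dephasing channel: one party, say Alice, splits her space as $\mathcal H_A=\mathcal H_{A'}\otimes\mathcal H_X$, the map $\rho\mapsto\sum_i P_i\rho P_i$ is applied, where the $P_i$ are the one-dimensional projectors of some orthonormal basis of $\mathcal H_X$ (acting as the identity on the other systems),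 and $X$ is handed to Bob, so that afterwards Alice holds $\mathcal H_{A'}$ and Bob holds $\mathcal H_X\otimes\mathcal H_B$; and likewise from Bob to Alice. A party may be left with a one-dimensional (null) system. The thermodynamical cost of erasing entanglement in a state $\rho$ on $\mathcal H_A\otimes\mathcal H_B$ is $$\Delta_{sep}(\rho)=\inf_{\Lambda}\bigl(S(\Lambda(\rho))-S(\rho)\bigr),$$ where the infimum runs over all CLOCC operations $\Lambda$ such that $\Lambda(\rho)$ is separable with respect to the final division between Alice and Bob. **Theorem.** For every bipartite state $\rho$, $$\Delta_{sep}(\rho)\ \ge\ E_r(\rho).$$ -/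

import Mathlib

open scoped Kronecker ComplexOrder

/-- Operators on `ℂ^a ⊗ ℂ^b` (Alice's system has dimension `a`, Bob's has dimension `b`). A party
whose system is null has dimension `1`. -/
abbrev BiMat (a b : ℕ) : Type := Matrix (Fin a × Fin b) (Fin a × Fin b) ℂ

/-- A (mixed) quantum state: a positive semidefinite matrix of trace one. -/
structure IsDensity {n : Type*} [Fintype n] (ρ : Matrix n n ℂ) : Prop where
  posSemidef : ρ.PosSemidef
  trace_eq_one : ρ.trace = 1

/-- The base-two logarithm of a Hermitian matrix, by functional calculus. As `Real.logb 2 0 = 0`,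
the kernel contributes zero: this is the convention `0 log 0 = 0`, and for relative entropies
kernels are taken care of separately. -/
noncomputable def matLog {n : Type*} [Fintype n] [DecidableEq n] (ρ : Matrix n n ℂ) :
    Matrix n n ℂ :=
  cfc (Real.logb 2) ρ

/-- The von Neumann entropy `S(ρ) = -tr (ρ log ρ)`. -/
noncomputable def vnEntropy {n : Type*} [Fintype n] [DecidableEq n] (ρ : Matrix n n ℂ) : ℝ :=
  -(ρ * matLog ρ).trace.re

open Classical in
/-- The quantum relative entropy `S(ρ|σ) = tr (ρ log ρ) - tr (ρ log σ)`, which is `+∞` unless the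
support of `ρ` lies in the support of `σ`, that is, unless `ker σ ⊆ ker ρ`. -/
noncomputable def relEntropy {n : Type*} [Fintype n] [DecidableEq n] (ρ σ : Matrix n n ℂ) :
    EReal :=
  if ∀ v : n → ℂ, σ.mulVec v = 0 → ρ.mulVec v = 0 then
    (((ρ * matLog ρ).trace.re - (ρ * matLog σ).trace.re : ℝ) : EReal)
  else ⊤

/-- The separable states: convex combinations of product states. -/
def separableStates (a b : ℕ) : Set (BiMat a b) :=
  convexHull ℝ {σ | ∃ (α : Matrix (Fin a) (Fin a) ℂ) (β : Matrix (Fin b) (Fin b) ℂ),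
    IsDensity α ∧ IsDensity β ∧ σ = α ⊗ₖ β}

/-- The relative entropy of entanglement `E_r(ρ) = inf_σ S(ρ|σ)`, over separable states `σ`. -/
noncomputable def relEntEntanglement {a b : ℕ} (ρ : BiMat a b) : EReal :=
  ⨅ σ ∈ separableStates a b, relEntropy ρ σ

/-- The one-dimensional projector `|v⟩⟨v|` onto the line through a unit vector `v`. -/
def rankOneProj {x : ℕ} (v : EuclideanSpace ℂ (Fin x)) : Matrix (Fin x) (Fin x) ℂ :=
  Matrix.vecMulVec v.ofLp (star v.ofLp)

/-- The local unitary transformation `ρ ↦ (U ⊗ V) ρ (U ⊗ V)†`. -/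
def localUnitary {a b : ℕ} (U : Matrix.unitaryGroup (Fin a) ℂ) (V : Matrix.unitaryGroup (Fin b) ℂ)
    (ρ : BiMat a b) : BiMat a b :=
  ((U : Matrix (Fin a) (Fin a) ℂ) ⊗ₖ (V : Matrix (Fin b) (Fin b) ℂ)) * ρ *
    ((U : Matrix (Fin a) (Fin a) ℂ) ⊗ₖ (V : Matrix (Fin b) (Fin b) ℂ)).conjTranspose

/-- Alice splits her system `A` as `A' ⊗ X` (the identification `e`), and sends `X` to Bob through
the channel that completely dephases in the orthonormal basis `u` of `X`. Afterwards Alice holds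
`A'`, and Bob holds `X ⊗ B`, which is identified with `ℂ^b'` by `e'`. -/
noncomputable def sendAToB {a b a' b' x : ℕ} (e : Fin a ≃ Fin a' × Fin x)
    (e' : Fin x × Fin b ≃ Fin b')
    (u : OrthonormalBasis (Fin x) ℂ (EuclideanSpace ℂ (Fin x))) (ρ : BiMat a b) : BiMat a' b' :=
  let E : Fin a × Fin b ≃ (Fin a' × Fin x) × Fin b := e.prodCongr (Equiv.refl _)
  let F : (Fin a' × Fin x) × Fin b ≃ Fin a' × Fin b' :=
    (Equiv.prodAssoc _ _ _).trans ((Equiv.refl _).prodCongr e')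
  let Q : Fin x → Matrix ((Fin a' × Fin x) × Fin b) ((Fin a' × Fin x) × Fin b) ℂ := fun i =>
    ((1 : Matrix (Fin a') (Fin a') ℂ) ⊗ₖ rankOneProj (u i)) ⊗ₖ (1 : Matrix (Fin b) (Fin b) ℂ)
  Matrix.reindex F F (∑ i, Q i * Matrix.reindex E E ρ * Q i)

/-- Bob splits his system `B` as `X ⊗ B'` (the identification `e`), and sends `X` to Alice through
the channel that completely dephases in the orthonormal basis `u` of `X`. Afterwards Bob holds
`B'`, and Alice holds `A ⊗ X`, which is identified with `ℂ^a'` by `e'`. -/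
noncomputable def sendBToA {a b a' b' x : ℕ} (e : Fin b ≃ Fin x × Fin b')
    (e' : Fin a × Fin x ≃ Fin a')
    (u : OrthonormalBasis (Fin x) ℂ (EuclideanSpace ℂ (Fin x))) (ρ : BiMat a b) : BiMat a' b' :=
  let E : Fin a × Fin b ≃ Fin a × (Fin x × Fin b') := (Equiv.refl _).prodCongr e
  let F : Fin a × (Fin x × Fin b') ≃ Fin a' × Fin b' :=
    (Equiv.prodAssoc _ _ _).symm.trans (e'.prodCongr (Equiv.refl _))
  let Q : Fin x → Matrix (Fin a × (Fin x × Fin b')) (Fin a × (Fin x × Fin b')) ℂ := fun i =>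
    (1 : Matrix (Fin a) (Fin a) ℂ) ⊗ₖ (rankOneProj (u i) ⊗ₖ (1 : Matrix (Fin b') (Fin b') ℂ))
  Matrix.reindex F F (∑ i, Q i * Matrix.reindex E E ρ * Q i)

/-- Closed local operations and classical communication (CLOCC): all maps composed out of local
unitary transformations and sending subsystems down a completely dephasing channel, in either
direction. The dimension of the total system does not change. -/
inductive IsCLOCC : {a b a' b' : ℕ} → (BiMat a b → BiMat a' b') → Prop
  | localUnitary {a b : ℕ} (U : Matrix.unitaryGroup (Fin a) ℂ)
      (V : Matrix.unitaryGroup (Fin b) ℂ) : IsCLOCC (localUnitary U V)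
  | sendAToB {a b a' b' x : ℕ} (e : Fin a ≃ Fin a' × Fin x) (e' : Fin x × Fin b ≃ Fin b')
      (u : OrthonormalBasis (Fin x) ℂ (EuclideanSpace ℂ (Fin x))) : IsCLOCC (sendAToB e e' u)
  | sendBToA {a b a' b' x : ℕ} (e : Fin b ≃ Fin x × Fin b') (e' : Fin a × Fin x ≃ Fin a')
      (u : OrthonormalBasis (Fin x) ℂ (EuclideanSpace ℂ (Fin x))) : IsCLOCC (sendBToA e e' u)
  | comp {a b a' b' a'' b'' : ℕ} {Λ : BiMat a b → BiMat a' b'} {Γ : BiMat a' b' → BiMat a'' b''} :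
      IsCLOCC Γ → IsCLOCC Λ → IsCLOCC (Γ ∘ Λ)

/-- The thermodynamical cost of erasing entanglement: the infimum of the entropy increase
`S(Λ(ρ)) - S(ρ)` over all CLOCC maps `Λ` (with any output dimensions that such a map can have)
for which `Λ(ρ)` is separable. -/
noncomputable def erasureCost {a b : ℕ} (ρ : BiMat a b) : EReal :=
  ⨅ (a' : ℕ) (b' : ℕ) (Λ : BiMat a b → BiMat a' b') (_ : IsCLOCC Λ)
    (_ : Λ ρ ∈ separableStates a' b'), ((vnEntropy (Λ ρ) - vnEntropy ρ : ℝ) : EReal)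

/-!
Lower bound on the cost of erasing entanglement by the relative entropy of entanglement.

Since `S(ρ|σ) = -S(ρ) - tr ρ log σ`, the claim is that some separable `τ` on the input space has
`-tr ρ log τ ≤ S(Λ(ρ))`, up to an arbitrarily small error. If `Λ(ρ)` is separable, then
`S(Λ(ρ)) = -tr Λ(ρ) log σ` for the separable state `σ = Λ(ρ)`, so it suffices to pull separable
states `σ` back along `Λ` without increasing the cross term:
`-tr ρ log τ ≤ -tr Λ(ρ) log σ` (`IsCLOCC.exists_separable_pullback`). This is done one elementary
operation at a time.

* For a local unitary transformation, `τ` is the image of `σ` under the inverse transformation, and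
  equality holds.
* For a dephasing channel `D` on a transferred system `X`, take `τ = D(σ)`, with `X` given back to
  the sender. As `X` is classical in `D(σ)`, this is separable for the division before the transfer
  as well as for the one after it (`relabelPinching_sendAToB_mem_separableStates` and its mirror
  image). The inequality `tr D(ρ) log σ = tr ρ D(log σ) ≤ tr ρ log D(σ)` is Jensen's operator
  inequality `D(log σ) ≤ log D(σ)` (`IsProjResolution.pinching_matLog_le`): a dephasing is the
  average of the conjugations by the unitaries `∑ i, ± P i`, and the logarithm is operator concave.

To avoid questions of support, only invertible `σ` are pulled back. This costs nothing in the
limit: mixing `Λ(ρ)` with a weight `ε` of the maximally mixed state raises `-tr Λ(ρ) log σ` by at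
most `-log (1 - ε)` (`neg_trace_mul_matLog_mix_le`).
-/

open scoped MatrixOrder Matrix.Norms.L2Operator

/-! ### The matrix logarithm -/

section Log

variable {m n : Type*} [Fintype m] [DecidableEq m] [Fintype n] [DecidableEq n]

theorem matLog_eq_smul_log (σ : Matrix n n ℂ) : matLog σ = (Real.log 2)⁻¹ • CFC.log σ := by
  unfold matLog CFC.log
  rw [← cfc_smul _ _ _ (by exact (Set.toFinite _).continuousOn _)]
  congr 1
  ext x
  simp [Real.logb, div_eq_inv_mul]

theorem StarAlgEquiv.map_matLog (Φ : Matrix m m ℂ ≃⋆ₐ[ℂ] Matrix n n ℂ) {σ : Matrix m m ℂ}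
    (hσ : σ.IsHermitian) : matLog (Φ σ) = Φ (matLog σ) := by
  have hΦ : Continuous Φ :=
    LinearMap.continuous_of_finiteDimensional (Φ.toAlgEquiv.toLinearMap)
  exact (StarAlgHomClass.map_cfc (S := ℂ) Φ (Real.logb 2) σ ((Set.toFinite _).continuousOn _) hΦ
    hσ.isSelfAdjoint (hσ.isSelfAdjoint.map Φ)).symm

theorem matLog_reindex (e : m ≃ n) {σ : Matrix m m ℂ} (hσ : σ.IsHermitian) :
    matLog (Matrix.reindex e e σ) = Matrix.reindex e e (matLog σ) :=
  (StarAlgEquiv.ofAlgEquiv (Matrix.reindexAlgEquiv ℂ ℂ e) fun _ => rfl).map_matLog hσ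

theorem matLog_unitary_conj (U : Matrix.unitaryGroup n ℂ) {σ : Matrix n n ℂ}
    (hσ : σ.IsHermitian) :
    matLog ((U : Matrix n n ℂ) * σ * (U : Matrix n n ℂ).conjTranspose) =
      (U : Matrix n n ℂ) * matLog σ * (U : Matrix n n ℂ).conjTranspose :=
  (Unitary.conjStarAlgAut ℂ (Matrix n n ℂ) U).map_matLog hσ

/-- The matrix logarithm is operator concave. -/
theorem concaveOn_matLog : ConcaveOn ℝ {σ : Matrix n n ℂ | σ.PosDef} matLog := by
  have h := (CFC.concaveOn_log (A := Matrix n n ℂ)).smul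
    (inv_nonneg.2 (Real.log_nonneg one_le_two))
  simp only [Matrix.isStrictlyPositive_iff_posDef] at h
  exact h.congr fun σ _ => (matLog_eq_smul_log σ).symm

omit [DecidableEq m] [DecidableEq n] in
theorem trace_reindex_mul (e : m ≃ n) (A : Matrix m m ℂ) (B : Matrix n n ℂ) :
    (Matrix.reindex e e A * B).trace = (A * Matrix.reindex e.symm e.symm B).trace := by
  simp only [Matrix.trace, Matrix.diag, Matrix.mul_apply, Matrix.reindex_apply,
    Matrix.submatrix_apply, Equiv.symm_symm]
  rw [← e.sum_comp]
  refine Finset.sum_congr rfl fun i _ => ?_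
  rw [← e.sum_comp]
  simp

theorem trace_mul_re_nonneg {A B : Matrix n n ℂ} (hA : A.PosSemidef) (hB : B.PosSemidef) :
    0 ≤ (A * B).trace.re := by
  obtain ⟨C, rfl⟩ := CStarAlgebra.nonneg_iff_eq_star_mul_self.mp hA.nonneg
  rw [Matrix.mul_assoc, Matrix.trace_mul_comm]
  exact (RCLike.nonneg_iff.mp (hB.mul_mul_conjTranspose_same C).trace_nonneg).1

theorem trace_mul_re_mono {ρ A B : Matrix n n ℂ} (hρ : ρ.PosSemidef) (h : A ≤ B) :
    (ρ * A).trace.re ≤ (ρ * B).trace.re := by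
  have := trace_mul_re_nonneg hρ (Matrix.le_iff.1 h)
  rw [Matrix.mul_sub, Matrix.trace_sub, Complex.sub_re] at this
  linarith

end Log

/-! ### Pinching -/

section Pinching

variable {ι n : Type*} [Fintype ι] [DecidableEq ι] [Fintype n] [DecidableEq n]

/-- A family of mutually orthogonal projectors that sum to the identity. -/
structure IsProjResolution (Q : ι → Matrix n n ℂ) : Prop where
  isHermitian : ∀ i, (Q i).IsHermitian
  mul_eq : ∀ i j, Q i * Q j = if i = j then Q i else 0
  sum_eq_one : ∑ i, Q i = 1

/-- The pinching `A ↦ ∑ i, Q i * A * Q i`. -/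
def pinching (Q : ι → Matrix n n ℂ) (A : Matrix n n ℂ) : Matrix n n ℂ := ∑ i, Q i * A * Q i

/-- The self-adjoint unitary `∑ i, s i • Q i` attached to a choice of signs. -/
def signUnitary (Q : ι → Matrix n n ℂ) (s : ι → ℤˣ) : Matrix n n ℂ :=
  ∑ i, ((s i : ℤ) : ℂ) • Q i

/-- Distinct coordinates of a uniformly random sign vector are uncorrelated. -/
theorem sum_signs_mul (i j : ι) :
    ∑ s : ι → ℤˣ, ((s i : ℤ) : ℂ) * ((s j : ℤ) : ℂ) =
      if i = j then (Fintype.card (ι → ℤˣ) : ℂ) else 0 := by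
  split_ifs with h
  · subst h
    have (s : ι → ℤˣ) : ((s i : ℤ) : ℂ) * ((s i : ℤ) : ℂ) = 1 := by
      rcases Int.units_eq_one_or (s i) with h | h <;> simp [h]
    simp [this]
  · -- flipping the sign at `i` changes the sign of the summand
    have key := Equiv.sum_comp (Equiv.mulRight (Pi.mulSingle i (-1) : ι → ℤˣ))
      fun s : ι → ℤˣ => ((s i : ℤ) : ℂ) * ((s j : ℤ) : ℂ)
    simp only [Equiv.coe_mulRight, Pi.mul_apply, Pi.mulSingle_eq_same,
      Pi.mulSingle_eq_of_ne (Ne.symm h), mul_one, mul_neg, Units.val_neg, Int.cast_neg, neg_mul,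
      Finset.sum_neg_distrib] at key
    exact self_eq_neg.1 key.symm

omit [DecidableEq n] in
theorem sum_signUnitary_conj (Q : ι → Matrix n n ℂ) (A : Matrix n n ℂ) :
    ∑ s, signUnitary Q s * A * signUnitary Q s =
      (Fintype.card (ι → ℤˣ) : ℂ) • pinching Q A := by
  simp only [signUnitary, pinching, Finset.sum_mul, Finset.mul_sum, Matrix.smul_mul,
    Matrix.mul_smul, smul_smul]
  rw [Finset.sum_comm]
  simp_rw [Finset.sum_comm (s := (Finset.univ : Finset (ι → ℤˣ))), ← Finset.sum_smul,
    sum_signs_mul, ite_smul, zero_smul]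
  simp [Finset.smul_sum]

omit [DecidableEq ι] [DecidableEq n] in
theorem trace_pinching_mul (Q : ι → Matrix n n ℂ) (A B : Matrix n n ℂ) :
    (pinching Q A * B).trace = (A * pinching Q B).trace := by
  simp only [pinching, Finset.sum_mul, Finset.mul_sum, Matrix.trace_sum]
  refine Finset.sum_congr rfl fun i _ => ?_
  rw [Matrix.mul_assoc, Matrix.mul_assoc, Matrix.trace_mul_comm, Matrix.mul_assoc]

namespace IsProjResolution

variable {Q : ι → Matrix n n ℂ} (hQ : IsProjResolution Q)
include hQ

theorem signUnitary_isHermitian (s : ι → ℤˣ) : (signUnitary Q s).IsHermitian := by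
  simp [Matrix.IsHermitian, signUnitary, Matrix.conjTranspose_sum, (hQ.isHermitian _).eq]

theorem signUnitary_mul_self (s : ι → ℤˣ) : signUnitary Q s * signUnitary Q s = 1 := by
  have (i : ι) : ((s i : ℤ) : ℂ) * ((s i : ℤ) : ℂ) = 1 := by
    rcases Int.units_eq_one_or (s i) with h | h <;> simp [h]
  simp [signUnitary, Finset.sum_mul, Finset.mul_sum, hQ.mul_eq, smul_smul, this, hQ.sum_eq_one]

theorem signUnitary_mem_unitaryGroup (s : ι → ℤˣ) :
    signUnitary Q s ∈ Matrix.unitaryGroup n ℂ := by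
  rw [Matrix.mem_unitaryGroup_iff, Matrix.star_eq_conjTranspose, hQ.signUnitary_isHermitian s,
    hQ.signUnitary_mul_self]

/-- A pinching is the uniform average of conjugations by the sign unitaries. -/
theorem pinching_eq_average (A : Matrix n n ℂ) :
    pinching Q A = ∑ s, ((Fintype.card (ι → ℤˣ) : ℝ)⁻¹) •
      (signUnitary Q s * A * (signUnitary Q s).conjTranspose) := by
  simp_rw [(hQ.signUnitary_isHermitian _).eq]
  rw [← Finset.smul_sum, sum_signUnitary_conj, ← Complex.coe_smul, smul_smul]
  simp

theorem posSemidef_pinching {A : Matrix n n ℂ} (hA : A.PosSemidef) :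
    (pinching Q A).PosSemidef := by
  refine Matrix.posSemidef_sum _ fun i _ => ?_
  have := hA.mul_mul_conjTranspose_same (Q i)
  rwa [(hQ.isHermitian i).eq] at this

theorem posDef_conj_signUnitary {A : Matrix n n ℂ} (hA : A.PosDef) (s : ι → ℤˣ) :
    (signUnitary Q s * A * (signUnitary Q s).conjTranspose).PosDef :=
  (Matrix.IsUnit.posDef_star_right_conjugate_iff
    (IsUnit.of_mul_eq_one _ (hQ.signUnitary_mul_self s))).2 hA

theorem posDef_pinching {A : Matrix n n ℂ} (hA : A.PosDef) : (pinching Q A).PosDef := by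
  rw [hQ.pinching_eq_average]
  exact concaveOn_matLog.1.sum_mem (fun _ _ => by positivity) (by simp)
    fun s _ => hQ.posDef_conj_signUnitary hA s

theorem trace_pinching (A : Matrix n n ℂ) : (pinching Q A).trace = A.trace := by
  have h := trace_pinching_mul Q A 1
  simpa [pinching, hQ.mul_eq, hQ.sum_eq_one] using h

/-- Jensen's operator inequality for a pinching: concavity of the logarithm, applied to the
average over sign unitaries. -/
theorem pinching_matLog_le {σ : Matrix n n ℂ} (hσ : σ.PosDef) :
    pinching Q (matLog σ) ≤ matLog (pinching Q σ) := by
  have h := concaveOn_matLog.le_map_sum (t := (Finset.univ : Finset (ι → ℤˣ)))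
    (w := fun _ => (Fintype.card (ι → ℤˣ) : ℝ)⁻¹)
    (fun _ _ => by positivity) (by simp) fun s _ => hQ.posDef_conj_signUnitary hσ s
  rw [← hQ.pinching_eq_average] at h
  rw [hQ.pinching_eq_average]
  refine le_trans (le_of_eq (Finset.sum_congr rfl fun s _ => ?_)) h
  rw [matLog_unitary_conj ⟨_, hQ.signUnitary_mem_unitaryGroup s⟩ hσ.isHermitian]

theorem trace_pinching_mul_matLog_le {ρ σ : Matrix n n ℂ} (hρ : ρ.PosSemidef) (hσ : σ.PosDef) :
    (pinching Q ρ * matLog σ).trace.re ≤ (ρ * matLog (pinching Q σ)).trace.re := by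
  rw [trace_pinching_mul]
  exact trace_mul_re_mono hρ (hQ.pinching_matLog_le hσ)

end IsProjResolution

/-- Moving a pinching, conjugated by relabellings of the basis, from a state to the second
argument of `tr ρ log σ` can only increase the value. -/
theorem trace_reindex_pinching_mul_matLog_le {m p : Type*} [Fintype m] [DecidableEq m]
    [Fintype p] [DecidableEq p] {Q : ι → Matrix n n ℂ} (hQ : IsProjResolution Q) (E : m ≃ n)
    (F : n ≃ p) {ρ : Matrix m m ℂ} {σ : Matrix p p ℂ} (hρ : ρ.PosSemidef) (hσ : σ.PosDef) :
    (Matrix.reindex F F (pinching Q (Matrix.reindex E E ρ)) * matLog σ).trace.re ≤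
      (ρ * matLog (Matrix.reindex E.symm E.symm
        (pinching Q (Matrix.reindex F.symm F.symm σ)))).trace.re := by
  have hσ' : (Matrix.reindex F.symm F.symm σ).PosDef := hσ.submatrix F.injective
  have hρ' : (Matrix.reindex E E ρ).PosSemidef := hρ.submatrix E.symm
  have h := hQ.trace_pinching_mul_matLog_le hρ' hσ'
  rw [matLog_reindex _ hσ.isHermitian, ← trace_reindex_mul F, trace_reindex_mul E,
    ← matLog_reindex _ (hQ.posDef_pinching hσ').isHermitian] at h
  exact h

end Pinching

/-! ### Separable states -/

section Separable

variable {a b a' b' : ℕ}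

theorem kronecker_mem_separableStates {α : Matrix (Fin a) (Fin a) ℂ}
    {β : Matrix (Fin b) (Fin b) ℂ} (hα : IsDensity α) (hβ : IsDensity β) :
    α ⊗ₖ β ∈ separableStates a b :=
  subset_convexHull ℝ _ ⟨α, β, hα, hβ, rfl⟩

theorem isDensity_inv_trace_smul {n : Type*} [Fintype n] {A : Matrix n n ℂ} (hA : A.PosSemidef)
    (h : A.trace ≠ 0) : IsDensity (A.trace⁻¹ • A) where
  posSemidef := hA.smul (inv_nonneg.2 hA.trace_nonneg)
  trace_eq_one := by simp [Matrix.trace_smul, h]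

/-- The factors of a sum of products need not be normalized: it is enough that they are positive
semidefinite and that the total trace is one. -/
theorem sum_kronecker_mem_separableStates {ι : Type*} [Fintype ι]
    {α : ι → Matrix (Fin a) (Fin a) ℂ} {β : ι → Matrix (Fin b) (Fin b) ℂ}
    (hα : ∀ i, (α i).PosSemidef) (hβ : ∀ i, (β i).PosSemidef)
    (h : (∑ i, α i ⊗ₖ β i).trace = 1) : ∑ i, α i ⊗ₖ β i ∈ separableStates a b := by
  classical
  set w : ι → ℝ := fun i => (α i ⊗ₖ β i).trace.re with hw
  have hpsd (i) := (hα i).kronecker (hβ i)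
  have hwt (i) : ((w i : ℝ) : ℂ) = (α i).trace * (β i).trace := by
    rw [← Matrix.trace_kronecker]
    exact (Complex.eq_re_of_ofReal_le (r := 0) (by simpa using (hpsd i).trace_nonneg)).symm
  have hzero (i) (hi : w i = 0) : α i ⊗ₖ β i = 0 := by
    rw [← (hpsd i).trace_eq_zero_iff, Matrix.trace_kronecker, ← hwt, hi, Complex.ofReal_zero]
  have key : ∑ i, α i ⊗ₖ β i = ∑ i with w i ≠ 0,
      w i • (((α i).trace⁻¹ • α i) ⊗ₖ ((β i).trace⁻¹ • β i)) := by
    rw [Finset.sum_filter]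
    refine Finset.sum_congr rfl fun i _ => ?_
    split_ifs with hi
    · have hne : (α i).trace * (β i).trace ≠ 0 := by
        rw [← hwt]
        exact_mod_cast hi
      rw [Matrix.smul_kronecker, Matrix.kronecker_smul, smul_smul, ← Complex.coe_smul, smul_smul,
        hwt, ← mul_inv, mul_inv_cancel₀ hne, one_smul]
    · exact hzero i (not_not.1 hi)
  rw [key]
  refine (convex_convexHull ℝ _).sum_mem (fun i _ => ?_) ?_ fun i hi => ?_
  · exact (RCLike.nonneg_iff.mp (hpsd i).trace_nonneg).1
  · rw [Finset.sum_filter_ne_zero]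
    simpa [Matrix.trace_sum] using congrArg Complex.re h
  · have hne : (α i).trace * (β i).trace ≠ 0 := by
      rw [← hwt]
      exact_mod_cast (Finset.mem_filter.1 hi).2
    exact kronecker_mem_separableStates (isDensity_inv_trace_smul (hα i) (left_ne_zero_of_mul hne))
      (isDensity_inv_trace_smul (hβ i) (right_ne_zero_of_mul hne))

/-- A linear map that sends product states to separable states sends separable states to
separable states. -/
theorem map_mem_separableStates (T : BiMat a b →ₗ[ℝ] BiMat a' b')
    (hT : ∀ α β, IsDensity α → IsDensity β → T (α ⊗ₖ β) ∈ separableStates a' b') {σ : BiMat a b}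
    (hσ : σ ∈ separableStates a b) : T σ ∈ separableStates a' b' := by
  refine convexHull_min (t := T ⁻¹' separableStates a' b') ?_
    ((convex_convexHull ℝ _).linear_preimage T) hσ
  rintro _ ⟨α, β, hα, hβ, rfl⟩
  exact hT α β hα hβ

theorem isDensity_of_mem_separableStates {σ : BiMat a b} (hσ : σ ∈ separableStates a b) :
    IsDensity σ := by
  refine convexHull_min (t := {σ : BiMat a b | IsDensity σ}) ?_ ?_ hσ
  · rintro _ ⟨α, β, hα, hβ, rfl⟩
    exact ⟨hα.posSemidef.kronecker hβ.posSemidef, by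
      rw [Matrix.trace_kronecker, hα.trace_eq_one, hβ.trace_eq_one, one_mul]⟩
  · intro A hA B hB s t hs ht hst
    refine ⟨(hA.posSemidef.smul hs).add (hB.posSemidef.smul ht), ?_⟩
    rw [Matrix.trace_add, Matrix.trace_smul, Matrix.trace_smul, hA.trace_eq_one, hB.trace_eq_one,
      ← add_smul, hst, one_smul]

/-- The maximally mixed state is separable. -/
theorem maximallyMixed_mem_separableStates (h : ((a : ℂ) * b) ≠ 0) :
    ((a * b : ℝ)⁻¹ • (1 : BiMat a b)) ∈ separableStates a b := by
  have := sum_kronecker_mem_separableStates (ι := Unit) (a := a) (b := b)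
    (α := fun _ => ((a * b : ℝ)⁻¹ • 1)) (β := fun _ => 1)
    (fun _ => Matrix.PosSemidef.one.smul (by positivity)) (fun _ => Matrix.PosSemidef.one) (by
      simp [Matrix.smul_kronecker, Matrix.trace_smul, ← Complex.coe_smul]
      field_simp [left_ne_zero_of_mul h, right_ne_zero_of_mul h])
  simpa [Matrix.smul_kronecker] using this

end Separable

/-! ### Rank-one projectors of an orthonormal basis -/

section RankOne

variable {x : ℕ}

theorem rankOneProj_posSemidef (v : EuclideanSpace ℂ (Fin x)) : (rankOneProj v).PosSemidef :=
  Matrix.posSemidef_vecMulVec_self_star _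

theorem rankOneProj_mul (u : OrthonormalBasis (Fin x) ℂ (EuclideanSpace ℂ (Fin x)))
    (i j : Fin x) :
    rankOneProj (u i) * rankOneProj (u j) = if i = j then rankOneProj (u i) else 0 := by
  have h := orthonormal_iff_ite.1 u.orthonormal i j
  rw [EuclideanSpace.inner_eq_star_dotProduct, dotProduct_comm] at h
  rw [rankOneProj, rankOneProj, Matrix.vecMulVec_mul_vecMulVec, h]
  split_ifs with hij
  · simp [hij]
  · simp

theorem sum_rankOneProj (u : OrthonormalBasis (Fin x) ℂ (EuclideanSpace ℂ (Fin x))) :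
    ∑ i, rankOneProj (u i) = 1 := by
  apply Matrix.toEuclideanLin.injective
  ext v k
  have h := congrArg (fun w => w.ofLp k) (u.sum_repr' v)
  simp only [EuclideanSpace.inner_eq_star_dotProduct] at h
  simp [Matrix.toLpLin_apply, rankOneProj, Matrix.vecMulVec_mulVec] at h ⊢
  rw [← h]
  exact Finset.sum_congr rfl fun i _ => by rw [dotProduct_comm]

theorem isProjResolution_rankOneProj
    (u : OrthonormalBasis (Fin x) ℂ (EuclideanSpace ℂ (Fin x))) :
    IsProjResolution fun i => rankOneProj (u i) :=
  ⟨fun _ => (rankOneProj_posSemidef _).isHermitian, rankOneProj_mul u, sum_rankOneProj u⟩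

namespace IsProjResolution

variable {ι m n : Type*} [Fintype ι] [DecidableEq ι] [Fintype m] [DecidableEq m]
  [Fintype n] [DecidableEq n] {Q : ι → Matrix n n ℂ}

theorem one_kronecker (hQ : IsProjResolution Q) :
    IsProjResolution fun i => (1 : Matrix m m ℂ) ⊗ₖ Q i where
  isHermitian i := by
    rw [Matrix.IsHermitian, Matrix.conjTranspose_kronecker, hQ.isHermitian i,
      Matrix.conjTranspose_one]
  mul_eq i j := by
    rw [← Matrix.mul_kronecker_mul, hQ.mul_eq, one_mul]
    split_ifs <;> simp
  sum_eq_one := by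
    rw [← Matrix.one_kronecker_one, ← hQ.sum_eq_one]
    ext
    simp [Matrix.sum_apply, Finset.mul_sum]

theorem kronecker_one (hQ : IsProjResolution Q) :
    IsProjResolution fun i => Q i ⊗ₖ (1 : Matrix m m ℂ) where
  isHermitian i := by
    rw [Matrix.IsHermitian, Matrix.conjTranspose_kronecker, hQ.isHermitian i,
      Matrix.conjTranspose_one]
  mul_eq i j := by
    rw [← Matrix.mul_kronecker_mul, hQ.mul_eq, one_mul]
    split_ifs <;> simp
  sum_eq_one := by
    rw [← Matrix.one_kronecker_one, ← hQ.sum_eq_one]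
    ext
    simp [Matrix.sum_apply, Finset.sum_mul]

end IsProjResolution

/-- Projecting the first factor onto a line leaves a product matrix. -/
theorem exists_rankOneProj_kronecker_one_conj {n : Type*} [Fintype n] [DecidableEq n]
    (v : EuclideanSpace ℂ (Fin x)) {β : Matrix (Fin x × n) (Fin x × n) ℂ} (hβ : β.PosSemidef) :
    ∃ γ : Matrix n n ℂ, γ.PosSemidef ∧
      (rankOneProj v ⊗ₖ (1 : Matrix n n ℂ)) * β * (rankOneProj v ⊗ₖ (1 : Matrix n n ℂ)) =
        rankOneProj v ⊗ₖ γ := by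
  -- `W` is the isometry `ξ ↦ v ⊗ ξ`
  let W : Matrix (Fin x × n) n ℂ := Matrix.of fun p j => v.ofLp p.1 * (1 : Matrix n n ℂ) p.2 j
  have hW (γ : Matrix n n ℂ) : W * γ * W.conjTranspose = rankOneProj v ⊗ₖ γ := by
    ext p q
    simp [W, Matrix.mul_apply, rankOneProj, Matrix.vecMulVec_apply, Matrix.one_apply,
      apply_ite (starRingEnd ℂ)]
    ring
  refine ⟨W.conjTranspose * β * W, hβ.conjTranspose_mul_mul_same W, ?_⟩
  rw [← hW, ← hW]
  simp only [Matrix.mul_one, Matrix.mul_assoc]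

/-- Projecting the second factor onto a line leaves a product matrix. -/
theorem exists_one_kronecker_rankOneProj_conj {n : Type*} [Fintype n] [DecidableEq n]
    (v : EuclideanSpace ℂ (Fin x)) {α : Matrix (n × Fin x) (n × Fin x) ℂ} (hα : α.PosSemidef) :
    ∃ γ : Matrix n n ℂ, γ.PosSemidef ∧
      ((1 : Matrix n n ℂ) ⊗ₖ rankOneProj v) * α * ((1 : Matrix n n ℂ) ⊗ₖ rankOneProj v) =
        γ ⊗ₖ rankOneProj v := by
  obtain ⟨γ, hγ, h⟩ := exists_rankOneProj_kronecker_one_conj v (hα.submatrix Prod.swap)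
  refine ⟨γ, hγ, ?_⟩
  have hswap (A : Matrix n n ℂ) (B : Matrix (Fin x) (Fin x) ℂ) :
      (B ⊗ₖ A).submatrix Prod.swap Prod.swap = A ⊗ₖ B := by
    ext p q
    simp [mul_comm]
  rw [← hswap γ, ← h, ← hswap 1]
  rw [Matrix.submatrix_mul _ _ _ _ _ Prod.swap_bijective,
    Matrix.submatrix_mul _ _ _ _ _ Prod.swap_bijective, Matrix.submatrix_submatrix,
    Prod.swap_swap_eq, Matrix.submatrix_id_id]

end RankOne

/-! ### Dephasing channels pulled back to separable states -/

section Pullback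

variable {a b a' b' : ℕ}

/-- Relabel the basis, pinch, and relabel again, as a linear map. -/
def relabelPinching {ι m n p : Type*} [Fintype ι] [Fintype n] (E : m ≃ n) (F : n ≃ p)
    (Q : ι → Matrix n n ℂ) : Matrix m m ℂ →ₗ[ℝ] Matrix p p ℂ where
  toFun A := Matrix.reindex F F (pinching Q (Matrix.reindex E E A))
  map_add' A B := by
    ext
    simp [pinching, Matrix.submatrix_add, mul_add, add_mul, Finset.sum_add_distrib]
  map_smul' c A := by
    ext
    simp [pinching, Matrix.submatrix_smul, Matrix.sum_apply, Finset.mul_sum]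

theorem trace_reindex {m n : Type*} [Fintype m] [Fintype n] (e : m ≃ n) (A : Matrix m m ℂ) :
    (Matrix.reindex e e A).trace = A.trace :=
  e.symm.sum_comp fun i => A i i

theorem IsProjResolution.trace_relabelPinching {ι m n p : Type*} [Fintype ι] [DecidableEq ι]
    [Fintype m] [Fintype n] [DecidableEq n] [Fintype p] (E : m ≃ n) (F : n ≃ p)
    {Q : ι → Matrix n n ℂ} (hQ : IsProjResolution Q) (A : Matrix m m ℂ) :
    (relabelPinching E F Q A).trace = A.trace := by
  exact (trace_reindex F _).trans ((hQ.trace_pinching _).trans (trace_reindex E A))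

/-- Dephasing `X` while it is with Bob turns a state that is separable for the division `A' : XB`
into one that is separable for the division `A'X : B`. -/
theorem relabelPinching_sendAToB_mem_separableStates {x : ℕ} (e : Fin a ≃ Fin a' × Fin x)
    (e' : Fin x × Fin b ≃ Fin b')
    (u : OrthonormalBasis (Fin x) ℂ (EuclideanSpace ℂ (Fin x))) {σ : BiMat a' b'}
    (hσ : σ ∈ separableStates a' b') :
    relabelPinching
      ((Equiv.prodAssoc _ _ _).trans ((Equiv.refl _).prodCongr e')).symm
      (e.prodCongr (Equiv.refl _)).symm
      (fun i => ((1 : Matrix (Fin a') (Fin a') ℂ) ⊗ₖ rankOneProj (u i)) ⊗ₖ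
        (1 : Matrix (Fin b) (Fin b) ℂ)) σ ∈ separableStates a b := by
  refine map_mem_separableStates _ (fun α β hα hβ => ?_) hσ
  have hβ' : (Matrix.reindex e'.symm e'.symm β).PosSemidef :=
    hβ.posSemidef.submatrix e'
  choose γ hγ h using fun i => exists_rankOneProj_kronecker_one_conj (u i) hβ'
  have htr := ((isProjResolution_rankOneProj u).one_kronecker (m := Fin a')
    |>.kronecker_one (m := Fin b)).trace_relabelPinching
      ((Equiv.prodAssoc _ _ _).trans ((Equiv.refl _).prodCongr e')).symm
      (e.prodCongr (Equiv.refl _)).symm (α ⊗ₖ β)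
  rw [Matrix.trace_kronecker, hα.trace_eq_one, hβ.trace_eq_one, one_mul] at htr
  have key : relabelPinching
      ((Equiv.prodAssoc _ _ _).trans ((Equiv.refl _).prodCongr e')).symm
      (e.prodCongr (Equiv.refl _)).symm
      (fun i => ((1 : Matrix (Fin a') (Fin a') ℂ) ⊗ₖ rankOneProj (u i)) ⊗ₖ
        (1 : Matrix (Fin b) (Fin b) ℂ)) (α ⊗ₖ β) =
      ∑ i, Matrix.reindex e.symm e.symm (α ⊗ₖ rankOneProj (u i)) ⊗ₖ γ i := by
    have hterm (i : Fin x) : (((1 : Matrix (Fin a') (Fin a') ℂ) ⊗ₖ rankOneProj (u i)) ⊗ₖ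
        (1 : Matrix (Fin b) (Fin b) ℂ)) *
        Matrix.reindex (Equiv.prodAssoc _ _ _).symm (Equiv.prodAssoc _ _ _).symm
          (α ⊗ₖ Matrix.reindex e'.symm e'.symm β) *
        (((1 : Matrix (Fin a') (Fin a') ℂ) ⊗ₖ rankOneProj (u i)) ⊗ₖ
        (1 : Matrix (Fin b) (Fin b) ℂ)) = (α ⊗ₖ rankOneProj (u i)) ⊗ₖ γ i := by
      have hassoc {A : Matrix (Fin a') (Fin a') ℂ} {B : Matrix (Fin x) (Fin x) ℂ}
          {C : Matrix (Fin b) (Fin b) ℂ} : (A ⊗ₖ B) ⊗ₖ C =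
          Matrix.reindexAlgEquiv ℂ ℂ (Equiv.prodAssoc _ _ _).symm (A ⊗ₖ (B ⊗ₖ C)) := by
        ext
        simp [mul_assoc]
      have hre : Matrix.reindex (Equiv.prodAssoc (Fin a') (Fin x) (Fin b)).symm
          (Equiv.prodAssoc _ _ _).symm (α ⊗ₖ Matrix.reindex e'.symm e'.symm β) =
          Matrix.reindexAlgEquiv ℂ ℂ (Equiv.prodAssoc _ _ _).symm
            (α ⊗ₖ Matrix.reindex e'.symm e'.symm β) := rfl
      rw [hassoc, hassoc, hre, ← map_mul, ← map_mul, ← Matrix.mul_kronecker_mul,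
        ← Matrix.mul_kronecker_mul, h, one_mul, mul_one]
    have hre : Matrix.reindex ((Equiv.prodAssoc _ _ _).trans ((Equiv.refl _).prodCongr e')).symm
        ((Equiv.prodAssoc _ _ _).trans ((Equiv.refl _).prodCongr e')).symm (α ⊗ₖ β) =
        Matrix.reindex (Equiv.prodAssoc _ _ _).symm (Equiv.prodAssoc _ _ _).symm
          (α ⊗ₖ Matrix.reindex e'.symm e'.symm β) := rfl
    simp only [relabelPinching, pinching, LinearMap.coe_mk, AddHom.coe_mk]
    rw [hre, Finset.sum_congr rfl fun i _ => hterm i]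
    ext
    simp [Matrix.sum_apply]
  rw [key] at htr ⊢
  exact sum_kronecker_mem_separableStates
    (fun i => (hα.posSemidef.kronecker (rankOneProj_posSemidef _)).submatrix e) hγ htr

/-- Dephasing `X` while it is with Alice turns a state that is separable for the division
`AX : B'` into one that is separable for the division `A : XB'`. -/
theorem relabelPinching_sendBToA_mem_separableStates {x : ℕ} (e : Fin b ≃ Fin x × Fin b')
    (e' : Fin a × Fin x ≃ Fin a')
    (u : OrthonormalBasis (Fin x) ℂ (EuclideanSpace ℂ (Fin x))) {σ : BiMat a' b'}
    (hσ : σ ∈ separableStates a' b') :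
    relabelPinching
      ((Equiv.prodAssoc _ _ _).symm.trans (e'.prodCongr (Equiv.refl _))).symm
      ((Equiv.refl _).prodCongr e).symm
      (fun i => (1 : Matrix (Fin a) (Fin a) ℂ) ⊗ₖ (rankOneProj (u i) ⊗ₖ
        (1 : Matrix (Fin b') (Fin b') ℂ))) σ ∈ separableStates a b := by
  refine map_mem_separableStates _ (fun α β hα hβ => ?_) hσ
  have hα' : (Matrix.reindex e'.symm e'.symm α).PosSemidef :=
    hα.posSemidef.submatrix e'
  choose γ hγ h using fun i => exists_one_kronecker_rankOneProj_conj (u i) hα'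
  have htr := ((isProjResolution_rankOneProj u).kronecker_one (m := Fin b')
    |>.one_kronecker (m := Fin a)).trace_relabelPinching
      ((Equiv.prodAssoc _ _ _).symm.trans (e'.prodCongr (Equiv.refl _))).symm
      ((Equiv.refl _).prodCongr e).symm (α ⊗ₖ β)
  rw [Matrix.trace_kronecker, hα.trace_eq_one, hβ.trace_eq_one, one_mul] at htr
  have key : relabelPinching
      ((Equiv.prodAssoc _ _ _).symm.trans (e'.prodCongr (Equiv.refl _))).symm
      ((Equiv.refl _).prodCongr e).symm
      (fun i => (1 : Matrix (Fin a) (Fin a) ℂ) ⊗ₖ (rankOneProj (u i) ⊗ₖ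
        (1 : Matrix (Fin b') (Fin b') ℂ))) (α ⊗ₖ β) =
      ∑ i, γ i ⊗ₖ Matrix.reindex e.symm e.symm (rankOneProj (u i) ⊗ₖ β) := by
    have hterm (i : Fin x) : ((1 : Matrix (Fin a) (Fin a) ℂ) ⊗ₖ (rankOneProj (u i) ⊗ₖ
        (1 : Matrix (Fin b') (Fin b') ℂ))) *
        Matrix.reindex (Equiv.prodAssoc _ _ _) (Equiv.prodAssoc _ _ _)
          (Matrix.reindex e'.symm e'.symm α ⊗ₖ β) *
        ((1 : Matrix (Fin a) (Fin a) ℂ) ⊗ₖ (rankOneProj (u i) ⊗ₖ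
        (1 : Matrix (Fin b') (Fin b') ℂ))) = γ i ⊗ₖ (rankOneProj (u i) ⊗ₖ β) := by
      have hassoc {A : Matrix (Fin a) (Fin a) ℂ} {B : Matrix (Fin x) (Fin x) ℂ}
          {C : Matrix (Fin b') (Fin b') ℂ} : A ⊗ₖ (B ⊗ₖ C) =
          Matrix.reindexAlgEquiv ℂ ℂ (Equiv.prodAssoc _ _ _) ((A ⊗ₖ B) ⊗ₖ C) :=
        (Matrix.kronecker_assoc A B C).symm
      have hre : Matrix.reindex (Equiv.prodAssoc (Fin a) (Fin x) (Fin b'))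
          (Equiv.prodAssoc _ _ _) (Matrix.reindex e'.symm e'.symm α ⊗ₖ β) =
          Matrix.reindexAlgEquiv ℂ ℂ (Equiv.prodAssoc _ _ _)
            (Matrix.reindex e'.symm e'.symm α ⊗ₖ β) := rfl
      rw [hassoc, hassoc, hre, ← map_mul, ← map_mul, ← Matrix.mul_kronecker_mul,
        ← Matrix.mul_kronecker_mul, h, one_mul, mul_one]
    have hre : Matrix.reindex
        ((Equiv.prodAssoc _ _ _).symm.trans (e'.prodCongr (Equiv.refl _))).symm
        ((Equiv.prodAssoc _ _ _).symm.trans (e'.prodCongr (Equiv.refl _))).symm (α ⊗ₖ β) =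
        Matrix.reindex (Equiv.prodAssoc _ _ _) (Equiv.prodAssoc _ _ _)
          (Matrix.reindex e'.symm e'.symm α ⊗ₖ β) := rfl
    simp only [relabelPinching, pinching, LinearMap.coe_mk, AddHom.coe_mk]
    rw [hre, Finset.sum_congr rfl fun i _ => hterm i]
    ext
    simp [Matrix.sum_apply]
  rw [key] at htr ⊢
  exact sum_kronecker_mem_separableStates hγ
    (fun i => ((rankOneProj_posSemidef _).kronecker hβ.posSemidef).submatrix e) htr

theorem localUnitary_mem_separableStates (U : Matrix.unitaryGroup (Fin a) ℂ)
    (V : Matrix.unitaryGroup (Fin b) ℂ) {σ : BiMat a b} (hσ : σ ∈ separableStates a b) :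
    localUnitary U V σ ∈ separableStates a b := by
  have hconj {n : ℕ} (U : Matrix.unitaryGroup (Fin n) ℂ) {α : Matrix (Fin n) (Fin n) ℂ}
      (hα : IsDensity α) : IsDensity ((U : Matrix (Fin n) (Fin n) ℂ) * α *
        (U : Matrix (Fin n) (Fin n) ℂ).conjTranspose) :=
    ⟨hα.posSemidef.mul_mul_conjTranspose_same _, by
      rw [Matrix.trace_mul_cycle, ← Matrix.star_eq_conjTranspose,
        Unitary.coe_star_mul_self, one_mul, hα.trace_eq_one]⟩
  let T : BiMat a b →ₗ[ℝ] BiMat a b :=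
    { toFun := localUnitary U V
      map_add' := fun A B => by simp [localUnitary, mul_add, add_mul]
      map_smul' := fun c A => by simp [localUnitary] }
  refine map_mem_separableStates T (fun α β hα hβ => ?_) hσ
  have : T (α ⊗ₖ β) = ((U : Matrix (Fin a) (Fin a) ℂ) * α * (U : Matrix (Fin a) (Fin a) ℂ).conjTranspose) ⊗ₖ
      ((V : Matrix (Fin b) (Fin b) ℂ) * β * (V : Matrix (Fin b) (Fin b) ℂ).conjTranspose) := by
    change localUnitary U V (α ⊗ₖ β) = _
    rw [localUnitary, Matrix.conjTranspose_kronecker, Matrix.mul_kronecker_mul,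
      Matrix.mul_kronecker_mul]
  rw [this]
  exact kronecker_mem_separableStates (hconj U hα) (hconj V hβ)

end Pullback

/-! ### Closed local operations and classical communication -/

section CLOCC

theorem kronecker_mem_unitaryGroup {a b : ℕ} (U : Matrix.unitaryGroup (Fin a) ℂ)
    (V : Matrix.unitaryGroup (Fin b) ℂ) :
    (U : Matrix (Fin a) (Fin a) ℂ) ⊗ₖ (V : Matrix (Fin b) (Fin b) ℂ) ∈
      Matrix.unitaryGroup (Fin a × Fin b) ℂ :=
  Matrix.kronecker_mem_unitary U.2 V.2

theorem IsCLOCC.posSemidef {a b a' b' : ℕ} {Λ : BiMat a b → BiMat a' b'} (hΛ : IsCLOCC Λ)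
    {ρ : BiMat a b} (hρ : ρ.PosSemidef) : (Λ ρ).PosSemidef := by
  induction hΛ with
  | localUnitary U V => exact hρ.mul_mul_conjTranspose_same _
  | sendAToB e e' u =>
    exact (((isProjResolution_rankOneProj u).one_kronecker.kronecker_one).posSemidef_pinching
      (hρ.submatrix _)).submatrix _
  | sendBToA e e' u =>
    exact (((isProjResolution_rankOneProj u).kronecker_one.one_kronecker).posSemidef_pinching
      (hρ.submatrix _)).submatrix _
  | comp _ _ ih₁ ih₂ => exact ih₁ (ih₂ hρ)

/-- The key monotonicity: an invertible separable state `σ` on the output of a CLOCC map `Λ` can be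
pulled back to an invertible separable state `τ` on the input with
`-tr ρ log τ ≤ -tr Λ(ρ) log σ`. -/
theorem IsCLOCC.exists_separable_pullback {a b a' b' : ℕ} {Λ : BiMat a b → BiMat a' b'}
    (hΛ : IsCLOCC Λ) {ρ : BiMat a b} (hρ : ρ.PosSemidef) {σ : BiMat a' b'}
    (hσ : σ ∈ separableStates a' b') (hpos : σ.PosDef) :
    ∃ τ ∈ separableStates a b, τ.PosDef ∧
      (Λ ρ * matLog σ).trace.re ≤ (ρ * matLog τ).trace.re := by
  induction hΛ with
  | localUnitary U V =>
    -- `τ` is the image of `σ` under the inverse local unitary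
    refine ⟨_root_.localUnitary (star U) (star V) σ,
      localUnitary_mem_separableStates _ _ hσ, ?_, ?_⟩
    · exact (Matrix.IsUnit.posDef_star_right_conjugate_iff
        (Unitary.toUnits ⟨_, kronecker_mem_unitaryGroup (star U) (star V)⟩).isUnit).2 hpos
    · have hlog := matLog_unitary_conj ⟨_, kronecker_mem_unitaryGroup (star U) (star V)⟩
        hpos.isHermitian
      dsimp only at hlog
      rw [_root_.localUnitary, _root_.localUnitary, hlog]
      refine le_of_eq (congrArg Complex.re ?_)
      simp only [Unitary.coe_star, Matrix.star_eq_conjTranspose, Matrix.conjTranspose_kronecker,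
        Matrix.conjTranspose_conjTranspose]
      rw [Matrix.mul_assoc, Matrix.mul_assoc, Matrix.trace_mul_comm]
      simp only [Matrix.mul_assoc]
  | @sendAToB a b a' b' x e e' u =>
    have hQ := ((isProjResolution_rankOneProj u).one_kronecker (m := Fin a')).kronecker_one
      (m := Fin b)
    exact ⟨_, relabelPinching_sendAToB_mem_separableStates e e' u hσ,
      (hQ.posDef_pinching (hpos.submatrix (Equiv.injective _))).submatrix (Equiv.injective _),
      trace_reindex_pinching_mul_matLog_le hQ _ _ hρ hpos⟩
  | @sendBToA a b a' b' x e e' u =>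
    have hQ := ((isProjResolution_rankOneProj u).kronecker_one (m := Fin b')).one_kronecker
      (m := Fin a)
    exact ⟨_, relabelPinching_sendBToA_mem_separableStates e e' u hσ,
      (hQ.posDef_pinching (hpos.submatrix (Equiv.injective _))).submatrix (Equiv.injective _),
      trace_reindex_pinching_mul_matLog_le hQ _ _ hρ hpos⟩
  | comp _ hΛ ih₁ ih₂ =>
    obtain ⟨τ, hτ, hτpos, h⟩ := ih₁ (hΛ.posSemidef hρ) hσ hpos
    obtain ⟨τ', hτ', hτpos', h'⟩ := ih₂ hρ hτ hτpos
    exact ⟨τ', hτ', hτpos', h.trans h'⟩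

end CLOCC

/-! ### Regularizing a separable state -/

section Regularization

/-- Mixing a state with a multiple of the identity changes `-tr τ log τ` by at most
`-log (1 - ε)`. -/
theorem neg_trace_mul_matLog_mix_le {n : Type*} [Fintype n] [DecidableEq n] {τ : Matrix n n ℂ}
    (hτ : IsDensity τ) {ε c : ℝ} (hε : ε < 1) (hc : 0 ≤ c) :
    -(τ * matLog ((1 - ε) • τ + c • (1 : Matrix n n ℂ))).trace.re ≤
      vnEntropy τ - Real.logb 2 (1 - ε) := by
  have hsa : IsSelfAdjoint τ := hτ.posSemidef.isHermitian.isSelfAdjoint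
  have hcont (f : ℝ → ℝ) : ContinuousOn f (spectrum ℝ τ) := (Set.toFinite _).continuousOn _
  have hmix : (1 - ε) • τ + c • (1 : Matrix n n ℂ) = cfc (fun t : ℝ => (1 - ε) * t + c) τ := by
    rw [cfc_add_const _ _ _ (hcont _), cfc_const_mul_id _ _, Algebra.algebraMap_eq_smul_one]
  have hleft : τ * matLog ((1 - ε) • τ + c • (1 : Matrix n n ℂ)) =
      cfc (fun t : ℝ => t * Real.logb 2 ((1 - ε) * t + c)) τ := by
    rw [matLog, hmix, ← cfc_comp' _ _ _ (((Set.toFinite _).image _).continuousOn _) (hcont _),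
      cfc_mul _ _ _ (hcont _) (hcont _), cfc_id' ℝ τ]
  have hright : τ * matLog τ + Real.logb 2 (1 - ε) • τ =
      cfc (fun t : ℝ => t * Real.logb 2 t + Real.logb 2 (1 - ε) * t) τ := by
    rw [matLog, cfc_add _ _ _ (hcont _) (hcont _), cfc_mul _ _ _ (hcont _) (hcont _),
      cfc_id' ℝ τ, cfc_const_mul_id _ _]
  have hle : τ * matLog τ + Real.logb 2 (1 - ε) • τ ≤
      τ * matLog ((1 - ε) • τ + c • (1 : Matrix n n ℂ)) := by
    rw [hleft, hright]
    refine cfc_mono (fun t ht => ?_) (hcont _) (hcont _)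
    rcases (spectrum_nonneg_of_nonneg hτ.posSemidef.nonneg ht).eq_or_lt with rfl | ht0
    · simp
    · have h1 : 0 < 1 - ε := by linarith
      have h2 : Real.logb 2 ((1 - ε) * t) ≤ Real.logb 2 ((1 - ε) * t + c) :=
        Real.logb_le_logb_of_le one_lt_two (by positivity) (by linarith)
      rw [Real.logb_mul h1.ne' ht0.ne'] at h2
      nlinarith
  have h := (RCLike.nonneg_iff.mp (Matrix.le_iff.1 hle).trace_nonneg).1
  simp only [Matrix.trace_sub, Matrix.trace_add, Matrix.trace_smul, hτ.trace_eq_one, map_sub,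
    map_add, RCLike.re_to_complex, Complex.smul_re, Complex.one_re, smul_eq_mul, mul_one] at h
  rw [vnEntropy]
  linarith

/-- A separable state can be replaced by an invertible separable state at arbitrarily small cost. -/
theorem exists_posDef_separable_neg_trace_le {a b : ℕ} {τ : BiMat a b}
    (hτ : τ ∈ separableStates a b) {δ : ℝ} (hδ : 0 < δ) :
    ∃ σ ∈ separableStates a b, σ.PosDef ∧
      -(τ * matLog σ).trace.re ≤ vnEntropy τ + δ := by
  have hd := isDensity_of_mem_separableStates hτ
  have hne : (a : ℂ) * b ≠ 0 := by
    intro h0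
    have : IsEmpty (Fin a × Fin b) := by
      rw [← Fintype.card_eq_zero_iff]
      simpa using h0
    simpa [Matrix.trace] using hd.trace_eq_one
  have hab : (0 : ℝ) < a * b := lt_of_le_of_ne (by positivity) (by exact_mod_cast hne.symm)
  -- chosen so that `-log (1 - ε) = δ`
  set ε : ℝ := 1 - 2 ^ (-δ) with hε
  have h2 : (0 : ℝ) < 2 ^ (-δ) := by positivity
  have h2' : (2 : ℝ) ^ (-δ) < 1 := Real.rpow_lt_one_of_one_lt_of_neg one_lt_two (by linarith)
  have hε0 : 0 < ε := by linarith
  refine ⟨(1 - ε) • τ + (ε * (a * b : ℝ)⁻¹) • 1, ?_, ?_, ?_⟩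
  · rw [mul_smul]
    exact convex_convexHull ℝ _ hτ (maximallyMixed_mem_separableStates hne) (by linarith)
      hε0.le (by ring)
  · exact Matrix.PosDef.posSemidef_add (hd.posSemidef.smul (by linarith))
      (Matrix.PosDef.one.smul (by positivity))
  · refine (neg_trace_mul_matLog_mix_le hd (by linarith) (by positivity)).trans_eq ?_
    rw [hε, sub_sub_cancel, Real.logb_rpow two_pos (by norm_num), sub_neg_eq_add]

end Regularization

/-! ### The erasure bound -/

theorem relEntropy_eq_of_posDef {n : Type*} [Fintype n] [DecidableEq n] (ρ : Matrix n n ℂ)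
    {σ : Matrix n n ℂ} (hσ : σ.PosDef) :
    relEntropy ρ σ = ((-(ρ * matLog σ).trace.re - vnEntropy ρ : ℝ) : EReal) := by
  rw [relEntropy, if_pos]
  · rw [vnEntropy]
    congr 1
    ring
  · intro v hv
    have := Matrix.mulVec_injective_of_isUnit hσ.isUnit (hv.trans (Matrix.mulVec_zero σ).symm)
    rw [this, Matrix.mulVec_zero]

theorem mainTheorem3 {a b : ℕ} (ρ : BiMat a b) (hρ : IsDensity ρ) :
    relEntEntanglement ρ ≤ erasureCost ρ := by
  refine le_iInf fun a' => le_iInf fun b' => le_iInf fun Λ => le_iInf fun hΛ =>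
    le_iInf fun hsep => EReal.le_of_forall_lt_iff_le.1 fun z hz => ?_
  have hz' := EReal.coe_lt_coe_iff.1 hz
  obtain ⟨σ, hσ, hσpos, h⟩ := exists_posDef_separable_neg_trace_le hsep (sub_pos.2 hz')
  obtain ⟨τ, hτ, hτpos, h'⟩ := hΛ.exists_separable_pullback hρ.posSemidef hσ hσpos
  refine (iInf₂_le τ hτ).trans ?_
  rw [relEntropy_eq_of_posDef ρ hτpos]
  exact EReal.coe_le_coe_iff.2 (by linarith)
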